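/- **Theorem (Fomin's identity for loop-erased random walk, two paths).** Join points of $\mathbb{Z}^2$ at Euclidean distance $1$. Let $A\subset\mathbb{Z}^2$ contain the origin and be simply connected, i.e. $A$ and $\mathbb{Z}^2\setminus A$ are both non-empty and connected. Let $\partial A$ be the set of points of $\mathbb{Z}^2\setminus A$ at distance $1$ from $A$. Let $x^1,x^2,y^2,y^1\in\partial A$ be ordered counterclockwise around $\partial A$, that is, in cyclic order when the boundary is traversed with $A$ on the left. (The traversal runs through the lattice edges leading from $A$ to $\partial A$. A point of $\partial A$ may be met several times, once for each such edge ending in it, and the four points are required to be in this cyclic order whichever of their edges are chosen; in particular they are distinct. If $A$ has infinite boundary, the cyclic order is the one induced by the linear order along the boundary.) For $x,y\in\partial A$ let $h_{\partial A}(x,y)=\mathbf{P}^x\{S_1\in A,\ S_{\tau_A}=y\}$ be the discrete excursion Poisson kernel, where $S$ is simple random walk on $\mathbb{Z}^2$ and $\tau_A=\inf\{j\ge 1: S_j\notin A\}$. A discrete excursion in $A$ from $x$ to $y$ is a nearest-neighbour path $\omega=[\omega_0,\dots,\omega_k]$, $2\le k<\infty$, with $\omega_0=x$, $\omega_k=y$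 and $\omega_1,\dots,\omega_{k-1}\in A$. A simple random walk excursion from $x$ to $y$ is a random such path, whose law is obtained by giving each excursion of length $k$ the mass $4^{-k}$ and normalizing to total mass one. The loop erasure $\mathcal{L}(\omega)$ of a path $\omega$ is $[\omega_{s_0},\dots,\omega_{s_m}]$, where $s_0=\max\{j:\omega_j=\omega_0\}$, $s_i=\max\{j:\omega_j=\omega_{s_{i-1}+1}\}$ and $s_m=k$. Let $S^1$ and $S^2$ be independent simple random walk excursions in $A$ from $x^1$ to $y^1$ and from $x^2$ to $y^2$ respectively, and let $\mathcal{L}^1=\mathcal{L}(S^1)$. Then $h_{\partial A}(x^1,y^1)>0$, $h_{\partial A}(x^2,y^2)>0$ and $$\mathbf{P}\{\mathcal{L}^1\cap S^2=\emptyset\}=\frac{\det\begin{bmatrix}h_{\partial A}(x^1,y^1)&h_{\partial A}(x^1,y^2)\\ h_{\partial A}(x^2,y^1)&h_{\partial A}(x^2,y^2)\end{bmatrix}}{h_{\partial A}(x^1,y^1)\,h_{\partial A}(x^2,y^2)}.$$ -/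

import Mathlib

open MeasureTheory ProbabilityTheory

noncomputable section

namespace FominLERW

/-- The four unit vectors of the square lattice, in counterclockwise order
(east, north, west, south); adding `1` to the index is a quarter turn to the left. -/
def dir (d : Fin 4) : ℤ × ℤ :=
  (![(1, 0), (0, 1), (-1, 0), (0, -1)] : Fin 4 → ℤ × ℤ) d

/-- The square lattice: two points are adjacent when their Euclidean distance is one. -/
def lattice : SimpleGraph (ℤ × ℤ) where
  Adj p q := (p.1 - q.1) ^ 2 + (p.2 - q.2) ^ 2 = 1
  symm := ⟨fun p q h => by
    rw [← h]; ring⟩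
  loopless := ⟨fun p h => by simp at h⟩

/-- The outer boundary of `A`: the points outside `A` at distance one from `A`. -/
def outerBoundary (A : Set (ℤ × ℤ)) : Set (ℤ × ℤ) :=
  {z | z ∉ A ∧ ∃ a ∈ A, lattice.Adj z a}

/-- `A` and its complement are both non-empty and connected
(non-emptiness is part of `SimpleGraph.Connected`). -/
def IsSimplyConnected (A : Set (ℤ × ℤ)) : Prop :=
  (lattice.induce A).Connected ∧ (lattice.induce Aᶜ).Connected

/-! ### Counterclockwise order on the boundary

The boundary of `A` is traversed along the lattice edges that lead out of `A`. Such an edge is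
recorded as a pair `(a, d)` with `a ∈ A` and `a + dir d ∉ A`. -/

/-- `(a, d)` is an edge that leaves `A` at the point `z`. -/
def IsBoundaryEdgeAt (A : Set (ℤ × ℤ)) (z : ℤ × ℤ) (e : (ℤ × ℤ) × Fin 4) : Prop :=
  e.1 ∈ A ∧ z ∉ A ∧ e.1 + dir e.2 = z

open Classical in
/-- The boundary edge that follows `(a, d)` when one walks between `A` and its complement
keeping `A` on the left. The walker crosses `(a, d)` in the direction `dir (d + 1)`, and sees
`a + dir (d + 1)` ahead on the left and `a + dir d + dir (d + 1)` ahead on the right. -/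
def nextEdge (A : Set (ℤ × ℤ)) (e : (ℤ × ℤ) × Fin 4) : (ℤ × ℤ) × Fin 4 :=
  if e.1 + dir (e.2 + 1) ∉ A then (e.1, e.2 + 1)
  else if e.1 + dir e.2 + dir (e.2 + 1) ∉ A then (e.1 + dir (e.2 + 1), e.2)
  else (e.1 + dir e.2 + dir (e.2 + 1), e.2 - 1)

/-- Starting at `e₁`, the traversal of the boundary meets `e₂`, `e₃`, `e₄` in this order before
it repeats an edge. -/
def EdgesInOrderFrom (A : Set (ℤ × ℤ)) (e₁ e₂ e₃ e₄ : (ℤ × ℤ) × Fin 4) : Prop :=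
  ∃ k l m : ℕ, 0 < k ∧ k < l ∧ l < m ∧
    Set.InjOn (fun n : ℕ => (nextEdge A)^[n] e₁) (Set.Iic m) ∧
    (nextEdge A)^[k] e₁ = e₂ ∧ (nextEdge A)^[l] e₁ = e₃ ∧ (nextEdge A)^[m] e₁ = e₄

/-- The cyclic order of four boundary edges (if the boundary is infinite, the cyclic order is
the one that comes from the linear order along the boundary). -/
def EdgesCounterclockwise (A : Set (ℤ × ℤ)) (e₁ e₂ e₃ e₄ : (ℤ × ℤ) × Fin 4) : Prop :=
  EdgesInOrderFrom A e₁ e₂ e₃ e₄ ∨ EdgesInOrderFrom A e₂ e₃ e₄ e₁ ∨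
    EdgesInOrderFrom A e₃ e₄ e₁ e₂ ∨ EdgesInOrderFrom A e₄ e₁ e₂ e₃

/-- The points `z₁, z₂, z₃, z₄` of the boundary of `A` are ordered counterclockwise. A boundary
point may be met several times in one turn around `A`, once along each edge that leads to it
from `A`; the order has to be the same for all of them. -/
def OrderedCounterclockwise (A : Set (ℤ × ℤ)) (z₁ z₂ z₃ z₄ : ℤ × ℤ) : Prop :=
  z₁ ∈ outerBoundary A ∧ z₂ ∈ outerBoundary A ∧ z₃ ∈ outerBoundary A ∧ z₄ ∈ outerBoundary A ∧
    ∀ e₁ e₂ e₃ e₄ : (ℤ × ℤ) × Fin 4,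
      IsBoundaryEdgeAt A z₁ e₁ → IsBoundaryEdgeAt A z₂ e₂ →
      IsBoundaryEdgeAt A z₃ e₃ → IsBoundaryEdgeAt A z₄ e₄ →
      EdgesCounterclockwise A e₁ e₂ e₃ e₄

/-! ### Simple random walk and the discrete excursion Poisson kernel -/

/-- The law of a sequence of independent uniformly distributed steps. -/
def stepLaw : Measure (ℕ → Fin 4) :=
  Measure.infinitePi fun _ : ℕ => (PMF.uniformOfFintype (Fin 4)).toMeasure

/-- The walk that starts at `x` and takes the steps `ξ`. -/
def walk (x : ℤ × ℤ) (ξ : ℕ → Fin 4) (n : ℕ) : ℤ × ℤ :=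
  x + ∑ i ∈ Finset.range n, dir (ξ i)

/-- `τ = min {j ≥ 1 : S j ∉ A}` is finite, and `S τ = y`. -/
def ExitsAt (A : Set (ℤ × ℤ)) (S : ℕ → ℤ × ℤ) (y : ℤ × ℤ) : Prop :=
  ∃ τ : ℕ, IsLeast {j : ℕ | 1 ≤ j ∧ S j ∉ A} τ ∧ S τ = y

/-- The discrete excursion Poisson kernel: the probability that simple random walk from `x`
takes its first step into `A` and then leaves `A` at `y`. -/
def excursionPoissonKernel (A : Set (ℤ × ℤ)) (x y : ℤ × ℤ) : ℝ :=
  stepLaw.real {ξ | walk x ξ 1 ∈ A ∧ ExitsAt A (walk x ξ) y}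

/-! ### Excursions -/

/-- The discrete excursions in `A` from `x` to `y`, as lists of the points visited. -/
def excursionsBetween (A : Set (ℤ × ℤ)) (x y : ℤ × ℤ) : Set (List (ℤ × ℤ)) :=
  {ω | x ∈ outerBoundary A ∧ y ∈ outerBoundary A ∧ ω.IsChain lattice.Adj ∧
    ∃ ζ : List (ℤ × ℤ), ζ ≠ [] ∧ (∀ z ∈ ζ, z ∈ A) ∧ ω = x :: (ζ ++ [y])}

/-- All discrete excursions in `A`. -/
def excursions (A : Set (ℤ × ℤ)) : Set (List (ℤ × ℤ)) :=
  {ω | ∃ x y : ℤ × ℤ, ω ∈ excursionsBetween A x y}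

/-- Every set of finite lattice paths is measurable. -/
instance pathMeasurableSpace : MeasurableSpace (List (ℤ × ℤ)) := ⊤

/-- The simple random walk excursion measure on `A`: an excursion with `k` steps
(that is, a list of `k + 1` points) has mass `4⁻ᵏ`. -/
def excursionMeasure (A : Set (ℤ × ℤ)) : Measure (List (ℤ × ℤ)) :=
  Measure.sum fun ω : excursions A => ((4 : ENNReal)⁻¹ ^ (ω.1.length - 1)) • Measure.dirac ω.1

/-- The law of a simple random walk excursion from `x` to `y` in `A`: the excursion measure
restricted to the excursions from `x` to `y` and normalized to total mass one. -/
def excursionLaw (A : Set (ℤ × ℤ)) (x y : ℤ × ℤ) : Measure (List (ℤ × ℤ)) :=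
  ProbabilityTheory.cond (excursionMeasure A) (excursionsBetween A x y)

/-- Loop erasure. Keep the first point `a`, discard everything up to the last visit to `a`, and
continue in the same way with the rest of the path. Here `l.rtakeWhile (· ≠ a)` is the part of
`l` after the last occurrence of `a` (all of `l` if `a` does not occur). -/
def loopErasure : List (ℤ × ℤ) → List (ℤ × ℤ)
  | [] => []
  | a :: l => a :: loopErasure (l.rtakeWhile (· ≠ a))
termination_by l => l.length
decreasing_by
  exact Nat.lt_succ_of_le (List.rtakeWhile_suffix _ _).length_le

end FominLERW

end

open MeasureTheory ProbabilityTheory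

noncomputable section

namespace FominLERW

/-! ### Loop erasure -/

/-! The complementary event is computed by exchanging tails. If the loop erasure of `ω₁` meets `ω₂`,
let `v` be its first point on `ω₂`, cut both paths at their last visits to `v`, and swap the
remainders. The total number of steps, hence the weight, is unchanged. The part of the loop erasure
up to `v` is determined by the head of `ω₁` and avoids both tails and the other head, so the new
pair is cut at the same `v` and the exchange is an involution (`IsTailCut.swap`, `IsTailCut.unique`,
`tsum_meetingPairs_swap`). It carries meeting pairs with endpoints `x₁ → y₁`, `x₂ → y₂` to meeting
pairs with endpoints `x₁ → y₂`, `x₂ → y₁`.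

For the latter endpoints every pair meets, so their mass is the full product (`tsum_meetingPairs`).
This is planarity: a path in `A` between two boundary edges, closed up through the connected
complement, gives a closed lattice path whose ray-crossing parity is constant along any path that
misses it. Along the boundary traversal this parity changes exactly at the two chosen edges, so it
separates the other two (`not_disjoint_of_counterclockwise`).

Finally the kernel is the total weight of the excursions (`stepLaw_exit_event`). Dividing by the two
normalizing masses and taking the complement gives the determinant. -/

theorem eq_append_cons_of_mem_last {α : Type*} {a : α} {l : List α} (h : a ∈ l) :
    ∃ q t, l = q ++ a :: t ∧ a ∉ t := by
  obtain ⟨s, t, h1, h2⟩ := List.eq_append_cons_of_mem (List.mem_reverse.2 h)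
  refine ⟨t.reverse, s.reverse, ?_, by simpa using h2⟩
  rw [← List.reverse_reverse l, h1]
  simp

theorem append_cons_inj_last {α : Type*} {v : α} {p s p' s' : List α}
    (h : p ++ v :: s = p' ++ v :: s') (hs : v ∉ s) (hs' : v ∉ s') : p = p' ∧ s = s' := by
  rcases List.append_eq_append_iff.1 h with ⟨γ, rfl, h2⟩ | ⟨γ, rfl, h2⟩ <;> cases γ <;> simp_all

theorem loopErasure_nil : loopErasure [] = [] := by rw [loopErasure]

theorem rtakeWhile_ne_append_cons (q : List (ℤ × ℤ)) (a : ℤ × ℤ) (t : List (ℤ × ℤ))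
    (h : a ∉ t) : (q ++ a :: t).rtakeWhile (· ≠ a) = t := by
  have h1 : ∀ x ∈ t.reverse, decide (x ≠ a) = true := by
    intro x hx
    have : x ≠ a := by
      rintro rfl
      exact h (by simpa using hx)
    simpa using this
  rw [List.rtakeWhile, List.reverse_append, List.reverse_cons, List.append_assoc,
    List.takeWhile_append_of_pos h1]
  simp

/-- Loop erasure discards everything before the last visit to the starting point. -/
theorem loopErasure_append_cons {q : List (ℤ × ℤ)} {a : ℤ × ℤ} {t : List (ℤ × ℤ)}
    (h : a ∉ t) (hq : ∀ b ∈ q.head?, b = a) :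
    loopErasure (q ++ a :: t) = a :: loopErasure t := by
  cases q with
  | nil =>
    have h1 : t.rtakeWhile (· ≠ a) = t := by
      rw [List.rtakeWhile_eq_self_iff]
      intro x hx
      have : x ≠ a := by
        rintro rfl
        exact h hx
      simpa using this
    rw [List.nil_append, loopErasure, h1]
  | cons b q =>
    obtain rfl : b = a := hq b (by simp)
    rw [List.cons_append, loopErasure, rtakeWhile_ne_append_cons _ _ _ h]

/-- The recursion of loop erasure as an induction principle: a nonempty list splits at the last
occurrence of its own head `a`, and the initial loop `q` (possibly empty) is stripped in one step.
-/
theorem loopErasure_induction {P : List (ℤ × ℤ) → Prop} (nil : P [])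
    (append_cons : ∀ q a t, a ∉ t → (∀ b ∈ q.head?, b = a) → P t → P (q ++ a :: t)) (l) : P l := by
  induction hn : l.length using Nat.strong_induction_on generalizing l with
  | _ n ih =>
    cases l with
    | nil => exact nil
    | cons a l =>
      obtain ⟨q, t, h, ht⟩ := eq_append_cons_of_mem_last (List.mem_cons_self (a := a) (l := l))
      rw [h]
      refine append_cons q a t ht ?_ (ih t.length ?_ t rfl)
      · cases q <;> simp_all
      · rw [← hn, h]
        simp
        omega

theorem loopErasure_subset (l : List (ℤ × ℤ)) : loopErasure l ⊆ l := by
  induction l using loopErasure_induction with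
  | nil => simp [loopErasure_nil]
  | append_cons q a t ha hq ih =>
    rw [loopErasure_append_cons ha hq]
    intro x hx
    rcases List.mem_cons.1 hx with rfl | hx
    · simp
    · simp [ih hx]

theorem head?_loopErasure (l : List (ℤ × ℤ)) : (loopErasure l).head? = l.head? := by
  cases l with
  | nil => rw [loopErasure_nil]
  | cons a l => rw [loopErasure]; simp

theorem getLast?_loopErasure (l : List (ℤ × ℤ)) : (loopErasure l).getLast? = l.getLast? := by
  induction l using loopErasure_induction with
  | nil => rw [loopErasure_nil]
  | append_cons q a t ha hq ih =>
    rw [loopErasure_append_cons ha hq]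
    simp [List.getLast?_cons, ih, List.getLast?_append]

theorem nodup_loopErasure (l : List (ℤ × ℤ)) : (loopErasure l).Nodup := by
  induction l using loopErasure_induction with
  | nil => simp [loopErasure_nil]
  | append_cons q a t ha hq ih =>
    rw [loopErasure_append_cons ha hq]
    exact List.nodup_cons.2 ⟨fun h => ha (loopErasure_subset t h), ih⟩

theorem isChain_loopErasure {R : ℤ × ℤ → ℤ × ℤ → Prop} (l : List (ℤ × ℤ)) (h : l.IsChain R) :
    (loopErasure l).IsChain R := by
  induction l using loopErasure_induction with
  | nil => simp [loopErasure_nil]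
  | append_cons q a t ha hq ih =>
    rw [loopErasure_append_cons ha hq]
    have h1 := (List.isChain_append.1 h).2.1
    rw [List.isChain_cons] at h1 ⊢
    rw [head?_loopErasure]
    exact ⟨h1.1, ih h1.2⟩

/-- Loop erasure only looks at last visits. A tail that avoids `α` and `v` does not move the last
visits to these points, so the erasure still runs through `α` to `v` and then starts afresh on the
tail. -/
theorem loopErasure_append_cons_of_disjoint (p : List (ℤ × ℤ)) :
    ∀ {v : ℤ × ℤ} {s α : List (ℤ × ℤ)}, loopErasure (p ++ [v]) = α ++ [v] → (∀ u ∈ α, u ∉ s) →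
      v ∉ s → loopErasure (p ++ v :: s) = α ++ v :: loopErasure s := by
  suffices H : ∀ l : List (ℤ × ℤ), ∀ p v s α, l = p ++ [v] → loopErasure l = α ++ [v] →
      (∀ u ∈ α, u ∉ s) → v ∉ s → loopErasure (p ++ v :: s) = α ++ v :: loopErasure s from
    fun {v s α} h1 h2 h3 => H _ p v s α rfl h1 h2 h3
  intro l
  induction l using loopErasure_induction with
  | nil => intro p v s α h; simp at h
  | append_cons q a t ha hq ih =>
    intro p v s α hl hL hα hv
    rw [loopErasure_append_cons ha hq] at hL
    rcases List.eq_nil_or_concat t with rfl | ⟨t, b, rfl⟩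
    · obtain ⟨rfl, h⟩ := List.append_inj' hl rfl
      obtain rfl : a = v := by simpa using h
      obtain rfl : α = [] := by
        rw [loopErasure_nil] at hL
        have := congrArg List.length hL
        simpa using this
      exact loopErasure_append_cons hv hq
    · simp only [List.concat_eq_append] at *
      have hl' : (q ++ a :: t) ++ [b] = p ++ [v] := by rw [← hl]; simp
      obtain ⟨rfl, h⟩ := List.append_inj' hl' rfl
      obtain rfl : b = v := by simpa using h
      cases α with
      | nil =>
        -- Here the erasure would end at its starting point, so `a = b`, although `a` does not occur
        -- after its last visit.
        exfalso
        obtain ⟨rfl, -⟩ := List.cons.inj hL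
        simp at ha
      | cons c α =>
        obtain ⟨rfl, h4⟩ := List.cons.inj hL
        have h5 := ih t b s α rfl h4 (fun u hu => hα u (by simp [hu])) hv
        rw [List.append_assoc, List.cons_append, loopErasure_append_cons ?_ hq, h5,
          List.cons_append]
        have := hα a (by simp)
        simp only [List.mem_append, List.mem_cons, List.not_mem_nil, or_false, not_or] at ha ⊢
        exact ⟨ha.1, ha.2, this⟩

/-- A path is cut at its last visit to a point of its loop erasure. -/
theorem exists_eq_append_of_loopErasure_eq (l : List (ℤ × ℤ)) :
    ∀ {v : ℤ × ℤ} {α β : List (ℤ × ℤ)}, loopErasure l = α ++ v :: β →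
      ∃ p s, l = p ++ v :: s ∧ loopErasure (p ++ [v]) = α ++ [v] ∧ v ∉ s ∧ ∀ u ∈ α, u ∉ s := by
  induction l using loopErasure_induction with
  | nil => intro v α β h; simp [loopErasure_nil] at h
  | append_cons q a t ha hq ih =>
    intro v α β h
    rw [loopErasure_append_cons ha hq] at h
    cases α with
    | nil =>
      obtain ⟨rfl, -⟩ := List.cons.inj h
      refine ⟨q, t, rfl, ?_, ha, by simp⟩
      rw [loopErasure_append_cons (by simp) hq, loopErasure_nil]
      rfl
    | cons c α =>
      obtain ⟨rfl, h1⟩ := List.cons.inj h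
      obtain ⟨p, s, rfl, h3, h4, h5⟩ := ih h1
      refine ⟨q ++ a :: p, s, by simp, ?_, h4, ?_⟩
      · rw [List.append_assoc, List.cons_append, loopErasure_append_cons ?_ hq, h3,
          List.cons_append]
        simp only [List.mem_append, List.mem_cons, not_or, List.not_mem_nil] at ha ⊢
        exact ⟨ha.1, ha.2.1, not_false⟩
      · intro u hu
        rcases List.mem_cons.1 hu with rfl | hu
        · simp only [List.mem_append, List.mem_cons, not_or] at ha
          exact ha.2.2
        · exact h5 u hu

/-! ### Exchange of tails -/

/-- Two paths `p ++ v :: s` and `q ++ v :: t`, cut at their last visits to `v`, where `v` is the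
first point of the loop erasure of the first path that the second one visits. -/
structure IsTailCut (p s q t : List (ℤ × ℤ)) (v : ℤ × ℤ) : Prop where
  left : v ∉ s
  right : v ∉ t
  erasure : ∃ α, loopErasure (p ++ [v]) = α ++ [v] ∧
    ∀ u ∈ α, u ≠ v ∧ u ∉ s ∧ u ∉ q ∧ u ∉ t

/-- The conditions are symmetric in the two tails, and `α` depends only on `p`. -/
theorem IsTailCut.swap {p s q t : List (ℤ × ℤ)} {v : ℤ × ℤ} (h : IsTailCut p s q t v) :
    IsTailCut p t q s v := by
  obtain ⟨h1, h2, α, h3, h4⟩ := h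
  exact ⟨h2, h1, α, h3, fun u hu => ⟨(h4 u hu).1, (h4 u hu).2.2.2, (h4 u hu).2.2.1, (h4 u hu).2.1⟩⟩

theorem IsTailCut.not_disjoint {p s q t : List (ℤ × ℤ)} {v : ℤ × ℤ} (h : IsTailCut p s q t v) :
    ¬ (loopErasure (p ++ v :: s)).Disjoint (q ++ v :: t) := by
  obtain ⟨h1, h2, α, h3, h4⟩ := h
  rw [loopErasure_append_cons_of_disjoint p h3 (fun u hu => (h4 u hu).2.1) h1]
  intro hd
  exact hd (a := v) (by simp) (by simp)

theorem exists_isTailCut {l m : List (ℤ × ℤ)} (h : ¬ (loopErasure l).Disjoint m) :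
    ∃ p s q t v, l = p ++ v :: s ∧ m = q ++ v :: t ∧ IsTailCut p s q t v := by
  classical
  obtain ⟨w, hw⟩ : ∃ w, (loopErasure l).find? (· ∈ m) = some w := by
    rw [← Option.isSome_iff_exists, List.find?_isSome]
    simp only [List.Disjoint] at h
    push Not at h
    obtain ⟨a, h1, h2⟩ := h
    exact ⟨a, h1, by simpa using h2⟩
  rw [List.find?_eq_some_iff_append] at hw
  obtain ⟨hw, α, β, h1, h2⟩ := hw
  have hw : w ∈ m := by simpa using hw
  obtain ⟨p, s, rfl, h3, h4, h5⟩ := exists_eq_append_of_loopErasure_eq l h1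
  obtain ⟨q, t, rfl, h6⟩ := eq_append_cons_of_mem_last hw
  refine ⟨p, s, q, t, w, rfl, rfl, h4, h6, α, h3, fun u hu => ?_⟩
  have h7 := h2 u hu
  simp only [List.mem_append, List.mem_cons, Bool.not_eq_true', decide_eq_false_iff_not,
    not_or] at h7
  exact ⟨h7.2.1, h5 u hu, h7.1, h7.2.2⟩

/-- If the cut points differed, one would come strictly earlier in the common loop erasure and so
lie in the other's `α`, which avoids the second path. Once `v` is known, cutting at its last
occurrence determines the pieces. -/
theorem IsTailCut.unique {p s q t p' s' q' t' : List (ℤ × ℤ)} {v v' : ℤ × ℤ}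
    (h : IsTailCut p s q t v) (h' : IsTailCut p' s' q' t' v')
    (e1 : p ++ v :: s = p' ++ v' :: s') (e2 : q ++ v :: t = q' ++ v' :: t') :
    p = p' ∧ s = s' ∧ q = q' ∧ t = t' ∧ v = v' := by
  obtain ⟨h1, h2, α, h3, h4⟩ := h
  obtain ⟨h1', h2', α', h3', h4'⟩ := h'
  have e3 := congrArg loopErasure e1
  rw [loopErasure_append_cons_of_disjoint p h3 (fun u hu => (h4 u hu).2.1) h1,
    loopErasure_append_cons_of_disjoint p' h3' (fun u hu => (h4' u hu).2.1) h1'] at e3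
  have h5 : v' ∉ α := fun hm => by
    have : v' ∈ q ++ v :: t := by rw [e2]; simp
    obtain ⟨i, -, j, k⟩ := h4 _ hm
    simp [i, j, k] at this
  have h5' : v ∉ α' := fun hm => by
    have : v ∈ q' ++ v' :: t' := by rw [← e2]; simp
    obtain ⟨i, -, j, k⟩ := h4' _ hm
    simp [i, j, k] at this
  obtain rfl : v = v' := by
    rcases List.append_eq_append_iff.1 e3 with ⟨γ, h6, h7⟩ | ⟨γ, h6, h7⟩
    · cases γ with
      | nil => simpa using (List.cons.inj h7).1
      | cons c γ =>
        obtain ⟨rfl, -⟩ := List.cons.inj h7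
        exact absurd (by rw [h6]; simp) h5'
    · cases γ with
      | nil => simpa using (List.cons.inj h7).1.symm
      | cons c γ =>
        obtain ⟨rfl, -⟩ := List.cons.inj h7
        exact absurd (by rw [h6]; simp) h5
  obtain ⟨rfl, rfl⟩ := append_cons_inj_last e1 h1 h1'
  obtain ⟨rfl, rfl⟩ := append_cons_inj_last e2 h2 h2'
  exact ⟨rfl, rfl, rfl, rfl, rfl⟩

/-! ### Lattice steps -/

theorem direction_cases (d : Fin 4) : d = 0 ∨ d = 1 ∨ d = 2 ∨ d = 3 := by
  revert d
  decide

theorem dir_injective : Function.Injective dir := by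
  intro d d'
  fin_cases d <;> fin_cases d' <;> simp [dir]

theorem adj_add_dir (p : ℤ × ℤ) (d : Fin 4) : lattice.Adj p (p + dir d) := by
  fin_cases d <;> simp [lattice, dir]

theorem exists_eq_add_dir {p q : ℤ × ℤ} (h : lattice.Adj p q) : ∃ d, q = p + dir d := by
  obtain ⟨a, b⟩ := p
  obtain ⟨c, e⟩ := q
  have h : (a - c) ^ 2 + (b - e) ^ 2 = 1 := h
  obtain ⟨x, rfl⟩ : ∃ x, c = a + x := ⟨c - a, by ring⟩
  obtain ⟨y, rfl⟩ : ∃ y, e = b + y := ⟨e - b, by ring⟩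
  have h1 : x ^ 2 + y ^ 2 = 1 := by rw [← h]; ring
  have hx : x ≤ 1 := by nlinarith
  have hx' : -1 ≤ x := by nlinarith
  have hy : y ≤ 1 := by nlinarith
  have hy' : -1 ≤ y := by nlinarith
  interval_cases x <;> interval_cases y <;> simp at h1
  · exact ⟨2, by simp [dir]⟩
  · exact ⟨3, by simp [dir]⟩
  · exact ⟨1, by simp [dir]⟩
  · exact ⟨0, by simp [dir]⟩

theorem exists_dir_eq_of_adj {p q : ℤ × ℤ} (h : lattice.Adj p q) : ∃ d, p = q + dir d :=
  exists_eq_add_dir h.symm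

/-! ### Sums along paths -/

/-- The sum of `c` over the steps of a path. -/
def pathSum (c : ℤ × ℤ → ℤ × ℤ → ZMod 2) : List (ℤ × ℤ) → ZMod 2
  | [] => 0
  | [_] => 0
  | p :: q :: l => c p q + pathSum c (q :: l)

theorem pathSum_append (c : ℤ × ℤ → ℤ × ℤ → ZMod 2) (l : List (ℤ × ℤ)) (u v : ℤ × ℤ)
    (m : List (ℤ × ℤ)) :
    pathSum c (l ++ u :: v :: m) = pathSum c (l ++ [u]) + c u v + pathSum c (v :: m) := by
  induction l with
  | nil => simp [pathSum]
  | cons p l ih =>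
    cases l with
    | nil => simp [pathSum, add_assoc]
    | cons q l =>
      simp only [List.cons_append, pathSum] at ih ⊢
      rw [ih]
      ring

theorem pathSum_eq_zero {c : ℤ × ℤ → ℤ × ℤ → ZMod 2} {l : List (ℤ × ℤ)}
    (h : ∀ p ∈ l, ∀ q ∈ l, c p q = 0) : pathSum c l = 0 := by
  induction l with
  | nil => rfl
  | cons p l ih =>
    cases l with
    | nil => rfl
    | cons q l =>
      rw [pathSum, h p (by simp) q (by simp), zero_add]
      exact ih fun p hp q hq => h p (List.mem_cons_of_mem _ hp) q (List.mem_cons_of_mem _ hq)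

theorem pathSum_add (c c' : ℤ × ℤ → ℤ × ℤ → ZMod 2) (l : List (ℤ × ℤ)) :
    pathSum (fun p q => c p q + c' p q) l = pathSum c l + pathSum c' l := by
  induction l with
  | nil => simp [pathSum]
  | cons p l ih =>
    cases l with
    | nil => simp [pathSum]
    | cons q l => simp only [pathSum, ih]; ring

/-- Interior terms occur twice and cancel modulo 2; on a closed path the endpoint terms cancel as
well. -/
theorem pathSum_telescope {c : ℤ × ℤ → ℤ × ℤ → ZMod 2} {g : ℤ × ℤ → ZMod 2}
    (h : ∀ p q, lattice.Adj p q → c p q = g p + g q) (a : ℤ × ℤ) (l : List (ℤ × ℤ))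
    (hl : (a :: l).IsChain lattice.Adj) :
    pathSum c (a :: l) = g a + g ((a :: l).getLast (by simp)) := by
  induction l generalizing a with
  | nil => simp [pathSum, CharTwo.add_self_eq_zero]
  | cons b l ih =>
    rw [List.isChain_cons_cons] at hl
    rw [pathSum, ih b hl.2, h a b hl.1, List.getLast_cons (List.cons_ne_nil b l)]
    linear_combination CharTwo.add_self_eq_zero (g b)

/-! ### Parity of the number of crossings of a ray -/

/-- The unit square (named by its lower left corner) at the point `a` between the directions
`d` and `d + 1`. -/
def corner (a : ℤ × ℤ) (d : Fin 4) : ℤ × ℤ :=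
  a + (![(0, 0), (-1, 0), (-1, -1), (0, -1)] : Fin 4 → ℤ × ℤ) d

/-- The indicator that the edge from `p` to `q` crosses the ray from the square `f` eastwards. -/
def rayCrossing (f p q : ℤ × ℤ) : ZMod 2 :=
  if p.1 = q.1 ∧ min p.2 q.2 = f.2 ∧ f.1 < p.1 then 1 else 0

/-- The indicator that `p` and `q` are, in some order, the points `a` and `b`. -/
def edgeIndicator (a b p q : ℤ × ℤ) : ZMod 2 :=
  if (p = a ∧ q = b) ∨ (p = b ∧ q = a) then 1 else 0

/-- The two squares are those on either side of the edge from `a` in direction `d`. If the edge is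
vertical, their rays lie in one row and differ by this edge alone, so `g = 0`. If it is horizontal,
`g` is the indicator of the half line of lattice points between the two rays: a step enters or
leaves it by crossing one of the rays or by using the edge. -/
theorem exists_rayCrossing_eq (a : ℤ × ℤ) (d : Fin 4) : ∃ g : ℤ × ℤ → ZMod 2,
    ∀ p q, lattice.Adj p q →
      rayCrossing (corner a d) p q + rayCrossing (corner a (d - 1)) p q +
        edgeIndicator a (a + dir d) p q = g p + g q := by
  obtain ⟨x, y⟩ := a
  refine ⟨fun p => ![if p.2 = y ∧ x < p.1 then 1 else 0, 0,
    if p.2 = y ∧ x ≤ p.1 then 1 else 0, 0] d, fun p q h => ?_⟩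
  obtain ⟨e, rfl⟩ := exists_eq_add_dir h
  obtain ⟨u, v⟩ := p
  rcases direction_cases d with rfl | rfl | rfl | rfl <;>
  rcases direction_cases e with rfl | rfl | rfl | rfl <;>
    simp [rayCrossing, corner, edgeIndicator, dir] <;> (try split_ifs) <;>
    first
    | rfl
    | omega

/-- The parity of the number of crossings between a path and the ray from a square eastwards. -/
def windingParity (l : List (ℤ × ℤ)) (f : ℤ × ℤ) : ZMod 2 :=
  pathSum (rayCrossing f) l

/-- Sum `exists_rayCrossing_eq` along the path: the potential `g` drops out because the path is
closed. -/
theorem windingParity_corner {a : ℤ × ℤ} {l : List (ℤ × ℤ)} (hl : (a :: l).IsChain lattice.Adj)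
    (hc : (a :: l).getLast (by simp) = a) (b : ℤ × ℤ) (d : Fin 4) :
    windingParity (a :: l) (corner b d) = windingParity (a :: l) (corner b (d - 1)) +
      pathSum (edgeIndicator b (b + dir d)) (a :: l) := by
  obtain ⟨g, hg⟩ := exists_rayCrossing_eq b d
  have h1 := pathSum_telescope hg a l hl
  rw [hc, pathSum_add, pathSum_add, CharTwo.add_self_eq_zero] at h1
  unfold windingParity
  linear_combination h1 -
    CharTwo.add_self_eq_zero (pathSum (rayCrossing (corner b (d - 1))) (a :: l)) -
    CharTwo.add_self_eq_zero (pathSum (edgeIndicator b (b + dir d)) (a :: l))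

/-- Neighbouring squares around `b` are separated by an edge at `b`, which a path avoiding `b` never
uses. -/
theorem windingParity_corner_eq {a : ℤ × ℤ} {l : List (ℤ × ℤ)}
    (hl : (a :: l).IsChain lattice.Adj) (hc : (a :: l).getLast (by simp) = a) {b : ℤ × ℤ}
    (hb : b ∉ a :: l) (d e : Fin 4) :
    windingParity (a :: l) (corner b d) = windingParity (a :: l) (corner b e) := by
  have h : ∀ d, windingParity (a :: l) (corner b d) =
      windingParity (a :: l) (corner b (d - 1)) := by
    intro d
    rw [windingParity_corner hl hc b d, pathSum_eq_zero, add_zero]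
    intro p hp q hq
    refine if_neg ?_
    rintro (⟨rfl, -⟩ | ⟨-, rfl⟩)
    · exact hb hp
    · exact hb hq
  have h' : ∀ d, windingParity (a :: l) (corner b d) = windingParity (a :: l) (corner b 0) := by
    have h1 := h 1
    have h2 := h 2
    have h3 := h 3
    simp only [Fin.reduceSub] at h1 h2 h3
    intro d
    fin_cases d
    · rfl
    · exact h1
    · exact h2.trans h1
    · exact h3.trans (h2.trans h1)
  rw [h' d, h' e]

theorem corner_add_dir (a : ℤ × ℤ) (d : Fin 4) : corner (a + dir d) (d + 2) = corner a (d - 1) := by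
  obtain ⟨x, y⟩ := a
  fin_cases d <;> simp [corner, dir]

/-- Adjacent points share a square (`corner_add_dir`), so the parity is carried from point to point
along `m`. -/
theorem windingParity_corner_eq_of_isChain {a : ℤ × ℤ} {l : List (ℤ × ℤ)}
    (hl : (a :: l).IsChain lattice.Adj) (hc : (a :: l).getLast (by simp) = a) {m : List (ℤ × ℤ)}
    (hm : m.IsChain lattice.Adj) (hd : ∀ q ∈ m, q ∉ a :: l) :
    ∀ p ∈ m.head?, ∀ q ∈ m.getLast?, ∀ d e, windingParity (a :: l) (corner p d) =
      windingParity (a :: l) (corner q e) := by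
  induction m with
  | nil => simp
  | cons b m ih =>
    cases m with
    | nil =>
      intro p hp q hq d e
      obtain rfl : b = p := by simpa using hp
      obtain rfl : b = q := by simpa using hq
      exact windingParity_corner_eq hl hc (hd b (by simp)) d e
    | cons c m =>
      intro p hp q hq d e
      obtain rfl : b = p := by simpa using hp
      rw [List.isChain_cons_cons] at hm
      obtain ⟨i, rfl⟩ := exists_eq_add_dir hm.1
      rw [← ih hm.2 (fun q hq => hd q (List.mem_cons_of_mem _ hq)) (b + dir i) (by simp) q
        (by simpa [List.getLast?_cons_cons] using hq) (i + 2) e, corner_add_dir]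
      exact windingParity_corner_eq hl hc (hd b (by simp)) _ _

/-! ### The traversal of the boundary -/

/-- `(a, d)` leads from `A` to its complement. -/
def IsBoundaryEdge (A : Set (ℤ × ℤ)) (e : (ℤ × ℤ) × Fin 4) : Prop :=
  e.1 ∈ A ∧ e.1 + dir e.2 ∉ A

theorem add_dir_dir_succ_sub (a : ℤ × ℤ) (d : Fin 4) :
    a + dir d + dir (d + 1) + dir (d - 1) = a + dir d := by
  obtain ⟨x, y⟩ := a
  fin_cases d <;> simp [dir]

theorem IsBoundaryEdge.nextEdge {A : Set (ℤ × ℤ)} {e : (ℤ × ℤ) × Fin 4}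
    (h : IsBoundaryEdge A e) : IsBoundaryEdge A (nextEdge A e) := by
  unfold FominLERW.nextEdge
  by_cases h1 : e.1 + dir (e.2 + 1) ∈ A
  · by_cases h2 : e.1 + dir e.2 + dir (e.2 + 1) ∈ A
    · rw [if_neg (not_not.2 h1), if_neg (not_not.2 h2)]
      exact ⟨h2, by simpa only [add_dir_dir_succ_sub] using h.2⟩
    · rw [if_neg (not_not.2 h1), if_pos h2]
      exact ⟨h1, by simpa only [add_right_comm] using h2⟩
  · rw [if_pos h1]
    exact ⟨h.1, h1⟩

/-- Between two consecutive boundary edges the traversal stays inside one unit square: it lies to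
the left of the first edge and to the right of the second, as seen looking out of `A`. The parity at
the right-hand square can therefore change only by crossing the current edge. -/
theorem corner_nextEdge (A : Set (ℤ × ℤ)) (e : (ℤ × ℤ) × Fin 4) :
    corner (nextEdge A e).1 ((nextEdge A e).2 - 1) = corner e.1 e.2 := by
  obtain ⟨⟨x, y⟩, d⟩ := e
  have h : (-1 - 1 : Fin 4) = 2 := rfl
  unfold nextEdge
  split_ifs <;> rcases direction_cases d with rfl | rfl | rfl | rfl <;> simp [corner, dir, h]

/-- A quantity that changes by one at each of two edges of the boundary traversal, and at no
other, changes between two moments separated by only one of these edges. -/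
theorem traversal_parity {A : Set (ℤ × ℤ)} {F : (ℤ × ℤ) × Fin 4 → ZMod 2}
    {e u u' : (ℤ × ℤ) × Fin 4} (he : IsBoundaryEdge A e)
    (hF : ∀ e, IsBoundaryEdge A e → F (nextEdge A e) =
      F e + ((if e = u then 1 else 0) + if e = u' then 1 else 0))
    {m i j l j' : ℕ} (hinj : Set.InjOn (fun n : ℕ => (nextEdge A)^[n] e) (Set.Iic m))
    (hij : i ≤ j) (hjl : j < l) (hlm : l ≤ m) (hj' : j' ≤ m) (hj'' : j' < i ∨ l ≤ j')
    (hu : (nextEdge A)^[j] e = u) (hu' : (nextEdge A)^[j'] e = u') :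
    F ((nextEdge A)^[l] e) = F ((nextEdge A)^[i] e) + 1 := by
  have hb : ∀ n, IsBoundaryEdge A ((nextEdge A)^[n] e) := by
    intro n
    induction n with
    | zero => exact he
    | succ n ih =>
      rw [Function.iterate_succ_apply']
      exact ih.nextEdge
  have hn : ∀ n ≤ m, ∀ k ≤ m, (nextEdge A)^[n] e = (nextEdge A)^[k] e → n = k :=
    fun n h k h' h2 => hinj h h' h2
  -- By injectivity `u` and `u'` are met only at the times `j` and `j'`, so `F` is constant on time
  -- intervals that avoid both.
  have hconst : ∀ a b, a ≤ b → b ≤ m → (∀ n, a ≤ n → n < b → n ≠ j ∧ n ≠ j') →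
      F ((nextEdge A)^[b] e) = F ((nextEdge A)^[a] e) := by
    intro a b hab
    induction b, hab using Nat.le_induction with
    | base => simp
    | succ b hab ih =>
      intro hbm h
      have h1 := h b hab (by omega)
      rw [Function.iterate_succ_apply', hF _ (hb b), if_neg, if_neg, add_zero, add_zero]
      · exact ih (by omega) fun n h2 h3 => h n h2 (by omega)
      · rw [← hu']
        exact fun h4 => h1.2 (hn b (by omega) j' hj' h4)
      · rw [← hu]
        exact fun h4 => h1.1 (hn b (by omega) j (by omega) h4)
  rw [hconst (j + 1) l (by omega) hlm (fun n _ _ => by omega), Function.iterate_succ_apply',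
    hF _ (hb j), if_pos hu, if_neg, add_zero,
    hconst i j hij (by omega) (fun n _ _ => by omega)]
  rw [← hu']
  exact fun h4 => by
    have := hn j (by omega) j' hj' h4
    omega

/-! ### Crossing paths -/

/-- Boundary edges are recorded from the inside out, so two of them cannot coincide with opposite
orientations. -/
theorem edgeIndicator_boundary {A : Set (ℤ × ℤ)} {e e' : (ℤ × ℤ) × Fin 4}
    (he : IsBoundaryEdge A e) (he' : IsBoundaryEdge A e') :
    edgeIndicator e.1 (e.1 + dir e.2) e'.1 (e'.1 + dir e'.2) = if e = e' then 1 else 0 := by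
  obtain ⟨a, d⟩ := e
  obtain ⟨b, d'⟩ := e'
  unfold edgeIndicator
  congr 1
  simp only [Prod.mk.injEq, eq_iff_iff]
  constructor
  · rintro (⟨rfl, h⟩ | ⟨h, -⟩)
    · exact ⟨rfl, (dir_injective (add_left_cancel h)).symm⟩
    · exact absurd (h ▸ he'.1) he.2
  · rintro ⟨rfl, rfl⟩
    exact Or.inl ⟨rfl, rfl⟩

theorem edgeIndicator_comm (a b p q : ℤ × ℤ) : edgeIndicator a b p q = edgeIndicator a b q p := by
  unfold edgeIndicator
  congr 1
  simp only [eq_iff_iff]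
  tauto

theorem exists_path_of_connected {B : Set (ℤ × ℤ)} (hB : (lattice.induce B).Connected)
    {x y : ℤ × ℤ} (hx : x ∈ B) (hy : y ∈ B) : ∃ l : List (ℤ × ℤ),
      (x :: l).IsChain lattice.Adj ∧ (x :: l).getLast? = some y ∧ ∀ z ∈ x :: l, z ∈ B := by
  obtain ⟨w⟩ := hB.preconnected ⟨x, hx⟩ ⟨y, hy⟩
  set w' := w.map (SimpleGraph.Embedding.induce B).toHom with hw'
  have h1 := w'.isChain_adj_support
  have h2 : w'.support.getLast? = some y := by
    rw [List.getLast?_eq_getLast_of_ne_nil w'.support_ne_nil, w'.getLast_support]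
    rfl
  have h3 : ∀ z ∈ w'.support, z ∈ B := by
    intro z hz
    rw [hw', SimpleGraph.Walk.support_map, List.mem_map] at hz
    obtain ⟨u, -, rfl⟩ := hz
    exact u.2
  rw [← w'.cons_tail_support] at h1 h2 h3
  exact ⟨_, h1, h2, h3⟩

/-- The steps of a closed path that consists of a path in `A` and one in the complement of `A`
cross the boundary of `A` at the two edges that join these paths. -/
theorem pathSum_edgeIndicator_closed {A : Set (ℤ × ℤ)} {e₁ e₃ e : (ℤ × ℤ) × Fin 4}
    (h₁ : IsBoundaryEdge A e₁) (h₃ : IsBoundaryEdge A e₃) (he : IsBoundaryEdge A e)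
    {ζ r : List (ℤ × ℤ)} (hζ : ∀ z ∈ ζ, z ∈ A) (hr : ∀ z ∈ r, z ∉ A)
    (hd : ζ.head? = some e₁.1) (hl : ζ.getLast? = some e₃.1)
    (hrd : r.head? = some (e₃.1 + dir e₃.2)) :
    pathSum (edgeIndicator e.1 (e.1 + dir e.2)) ((e₁.1 + dir e₁.2) :: (ζ ++ r)) =
      (if e = e₁ then 1 else 0) + if e = e₃ then 1 else 0 := by
  obtain ⟨ζ', rfl⟩ := List.getLast?_eq_some_iff.1 hl
  obtain ⟨r', rfl⟩ := List.head?_eq_some_iff.1 hrd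
  have hA : ∀ l : List (ℤ × ℤ), (∀ z ∈ l, z ∈ A) →
      pathSum (edgeIndicator e.1 (e.1 + dir e.2)) l = 0 := by
    intro l hl
    refine pathSum_eq_zero fun p hp q hq => if_neg ?_
    rintro (⟨-, rfl⟩ | ⟨rfl, -⟩)
    · exact he.2 (hl _ hq)
    · exact he.2 (hl _ hp)
  have hAc : ∀ l : List (ℤ × ℤ), (∀ z ∈ l, z ∉ A) →
      pathSum (edgeIndicator e.1 (e.1 + dir e.2)) l = 0 := by
    intro l hl
    refine pathSum_eq_zero fun p hp q hq => if_neg ?_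
    rintro (⟨rfl, -⟩ | ⟨-, rfl⟩)
    · exact hl _ hp he.1
    · exact hl _ hq he.1
  rw [List.append_assoc, List.singleton_append, ← List.cons_append, pathSum_append,
    hAc _ hr, edgeIndicator_boundary he h₃, add_zero, List.cons_append]
  congr 1
  obtain ⟨ζ'', h⟩ := List.head?_eq_some_iff.1 hd
  rw [h] at hζ ⊢
  rw [pathSum, hA _ hζ, edgeIndicator_comm, edgeIndicator_boundary he h₁, add_zero]

/-- Two paths in `A` that join the first to the third and the second to the fourth of four
boundary edges in cyclic order have a common point. -/
theorem not_disjoint_of_counterclockwise {A : Set (ℤ × ℤ)}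
    (hA : (lattice.induce Aᶜ).Connected) {e₁ e₂ e₃ e₄ : (ℤ × ℤ) × Fin 4}
    (h₁ : IsBoundaryEdge A e₁) (h₂ : IsBoundaryEdge A e₂) (h₃ : IsBoundaryEdge A e₃)
    (h₄ : IsBoundaryEdge A e₄) (hord : EdgesCounterclockwise A e₁ e₂ e₃ e₄)
    {ζ ξ : List (ℤ × ℤ)} (hζ : ∀ z ∈ ζ, z ∈ A) (hξ : ∀ z ∈ ξ, z ∈ A)
    (hζc : ζ.IsChain lattice.Adj) (hξc : ξ.IsChain lattice.Adj)
    (hζd : ζ.head? = some e₁.1) (hζl : ζ.getLast? = some e₃.1)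
    (hξd : ξ.head? = some e₂.1) (hξl : ξ.getLast? = some e₄.1) : ¬ ζ.Disjoint ξ := by
  intro hdis
  -- A path through the complement from the outer end of `e₃` back to that of `e₁` closes up `ζ`;
  -- `ξ` cannot meet it.
  obtain ⟨r, hr1, hr2, hr3⟩ := exists_path_of_connected hA h₃.2 h₁.2
  set r' := (e₃.1 + dir e₃.2) :: r with hr'
  set a := e₁.1 + dir e₁.2 with ha
  have hc : (a :: (ζ ++ r')).IsChain lattice.Adj := by
    rw [List.isChain_cons]
    refine ⟨?_, List.isChain_append.2 ⟨hζc, hr1, ?_⟩⟩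
    · rw [List.head?_append, hζd]
      intro y hy
      obtain rfl : e₁.1 = y := by simpa using hy
      exact (adj_add_dir _ _).symm
    · rw [hζl]
      intro x hx y hy
      obtain rfl : e₃.1 = x := by simpa using hx
      obtain rfl : e₃.1 + dir e₃.2 = y := by simpa [hr'] using hy
      exact adj_add_dir _ _
  have hlast : (a :: (ζ ++ r')).getLast (by simp) = a := by
    rw [List.getLast_cons (by simp [hr']), List.getLast_append_of_ne_nil _ (by simp [hr'])]
    simpa [hr', List.getLast?_eq_getLast_of_ne_nil] using hr2
  have hoff : ∀ q ∈ ξ, q ∉ a :: (ζ ++ r') := by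
    intro q hq hm
    rcases List.mem_cons.1 hm with rfl | hm
    · exact h₁.2 (hξ _ hq)
    · rcases List.mem_append.1 hm with hm | hm
      · exact hdis hm hq
      · exact hr3 _ hm (hξ _ hq)
  have hQ := windingParity_corner_eq_of_isChain hc hlast hξc hoff e₂.1 (by simp [hξd]) e₄.1
    (by simp [hξl]) (e₂.2 - 1) (e₄.2 - 1)
  have hF : ∀ e, IsBoundaryEdge A e →
      windingParity (a :: (ζ ++ r')) (corner (nextEdge A e).1 ((nextEdge A e).2 - 1)) =
      windingParity (a :: (ζ ++ r')) (corner e.1 (e.2 - 1)) +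
        ((if e = e₁ then 1 else 0) + if e = e₃ then 1 else 0) := by
    intro e he
    rw [corner_nextEdge, windingParity_corner hc hlast,
      pathSum_edgeIndicator_closed h₁ h₃ he hζ hr3 hζd hζl rfl]
  have hF' : ∀ e, IsBoundaryEdge A e →
      windingParity (a :: (ζ ++ r')) (corner (nextEdge A e).1 ((nextEdge A e).2 - 1)) =
      windingParity (a :: (ζ ++ r')) (corner e.1 (e.2 - 1)) +
        ((if e = e₃ then 1 else 0) + if e = e₁ then 1 else 0) := by
    intro e he
    rw [hF e he, add_comm (if e = e₃ then _ else _)]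
  set F : (ℤ × ℤ) × Fin 4 → ZMod 2 :=
    fun e => windingParity (a :: (ζ ++ r')) (corner e.1 (e.2 - 1))
  have hne : ∀ x y : ZMod 2, x = y → x ≠ y + 1 := by decide
  have hQ : F e₂ = F e₄ := hQ
  -- In each rotation exactly one of `e₁`, `e₃` is met between the visits to `e₂` and `e₄`, and the
  -- other at time `0` or `m`, outside that interval. So `F` differs at `e₂` and `e₄`, against `hQ`.
  rcases hord with ⟨k, l, m, h0, hkl, hlm, hinj, hk, hl, hm⟩ |
    ⟨k, l, m, h0, hkl, hlm, hinj, hk, hl, hm⟩ |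
    ⟨k, l, m, h0, hkl, hlm, hinj, hk, hl, hm⟩ | ⟨k, l, m, h0, hkl, hlm, hinj, hk, hl, hm⟩
  · have := traversal_parity (F := F) h₁ hF' (i := k) (j := l) (l := m) (j' := 0) hinj hkl.le hlm
      le_rfl (by omega) (by omega) hl rfl
    rw [hk, hm] at this
    exact hne _ _ hQ.symm this
  · have := traversal_parity (F := F) h₂ hF' (i := 0) (j := k) (l := l) (j' := m) hinj h0.le hkl
      hlm.le le_rfl (by omega) hk hm
    rw [hl] at this
    exact hne _ _ hQ.symm this
  · have := traversal_parity (F := F) h₃ hF (i := k) (j := l) (l := m) (j' := 0) hinj hkl.le hlm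
      le_rfl (by omega) (by omega) hl rfl
    rw [hk, hm] at this
    exact hne _ _ hQ this
  · have := traversal_parity (F := F) h₄ hF (i := 0) (j := k) (l := l) (j' := m) hinj h0.le hkl
      hlm.le le_rfl (by omega) hk hm
    rw [hl] at this
    exact hne _ _ hQ this

/-! ### Excursions between points in cyclic order -/

theorem EdgesInOrderFrom.nodup {A : Set (ℤ × ℤ)} {e₁ e₂ e₃ e₄ : (ℤ × ℤ) × Fin 4}
    (h : EdgesInOrderFrom A e₁ e₂ e₃ e₄) : [e₁, e₂, e₃, e₄].Nodup := by
  obtain ⟨k, l, m, h0, hkl, hlm, hinj, rfl, rfl, rfl⟩ := h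
  have hn : ∀ n ≤ m, ∀ k ≤ m, n < k → (nextEdge A)^[n] e₁ ≠ (nextEdge A)^[k] e₁ :=
    fun n h k h' h2 h3 => h2.ne (hinj h h' h3)
  have hn0 : ∀ k ≤ m, 0 < k → e₁ ≠ (nextEdge A)^[k] e₁ := fun k => hn 0 (by omega) k
  simp only [List.nodup_cons, List.mem_cons, List.not_mem_nil, or_false, not_or, not_false_eq_true,
    List.nodup_nil, and_true]
  exact ⟨⟨hn0 k (by omega) h0, hn0 l (by omega) (by omega), hn0 m le_rfl (by omega)⟩,
    ⟨hn k (by omega) l (by omega) hkl, hn k (by omega) m le_rfl (by omega)⟩,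
    hn l (by omega) m le_rfl hlm⟩

theorem EdgesCounterclockwise.nodup {A : Set (ℤ × ℤ)} {e₁ e₂ e₃ e₄ : (ℤ × ℤ) × Fin 4}
    (h : EdgesCounterclockwise A e₁ e₂ e₃ e₄) : [e₁, e₂, e₃, e₄].Nodup := by
  rcases h with h | h | h | h
  · exact h.nodup
  · exact (List.IsRotated.nodup_iff ⟨3, rfl⟩).1 h.nodup
  · exact (List.IsRotated.nodup_iff ⟨2, rfl⟩).1 h.nodup
  · exact (List.IsRotated.nodup_iff ⟨1, rfl⟩).1 h.nodup

theorem exists_isBoundaryEdgeAt {A : Set (ℤ × ℤ)} {z : ℤ × ℤ} (h : z ∈ outerBoundary A) :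
    ∃ e, IsBoundaryEdgeAt A z e := by
  obtain ⟨hz, a, ha, hza⟩ := h
  obtain ⟨d, rfl⟩ := exists_dir_eq_of_adj hza
  exact ⟨(a, d), ha, hz, rfl⟩

/-- The order is required for every choice of edges, so equal points could be given the same edge,
whereas edges in cyclic order are distinct. -/
theorem OrderedCounterclockwise.nodup {A : Set (ℤ × ℤ)} {z₁ z₂ z₃ z₄ : ℤ × ℤ}
    (h : OrderedCounterclockwise A z₁ z₂ z₃ z₄) : [z₁, z₂, z₃, z₄].Nodup := by
  obtain ⟨h₁, h₂, h₃, h₄, h⟩ := h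
  obtain ⟨e₁, h₁⟩ := exists_isBoundaryEdgeAt h₁
  obtain ⟨e₂, h₂⟩ := exists_isBoundaryEdgeAt h₂
  obtain ⟨e₃, h₃⟩ := exists_isBoundaryEdgeAt h₃
  obtain ⟨e₄, h₄⟩ := exists_isBoundaryEdgeAt h₄
  simp only [List.nodup_cons, List.mem_cons, List.not_mem_nil, or_false, not_or, not_false_eq_true,
    List.nodup_nil, and_true]
  refine ⟨⟨?_, ?_, ?_⟩, ⟨?_, ?_⟩, ?_⟩ <;> rintro rfl
  · simpa using (h e₁ e₁ e₃ e₄ h₁ h₁ h₃ h₄).nodup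
  · simpa using (h e₁ e₂ e₁ e₄ h₁ h₂ h₁ h₄).nodup
  · simpa using (h e₁ e₂ e₃ e₁ h₁ h₂ h₃ h₁).nodup
  · simpa using (h e₁ e₂ e₂ e₄ h₁ h₂ h₂ h₄).nodup
  · simpa using (h e₁ e₂ e₃ e₂ h₁ h₂ h₃ h₂).nodup
  · simpa using (h e₁ e₂ e₃ e₃ h₁ h₂ h₃ h₃).nodup

/-- As `x` is not revisited, only the rest of the path gets erased. That rest starts in `A` and ends
at `y ∉ A`, so an interior point survives. For `x = y` the erasure would collapse to one point. -/
theorem loopErasure_mem_excursionsBetween {A : Set (ℤ × ℤ)} {x y : ℤ × ℤ} (hxy : x ≠ y)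
    {ω : List (ℤ × ℤ)} (h : ω ∈ excursionsBetween A x y) :
    loopErasure ω ∈ excursionsBetween A x y := by
  obtain ⟨hx, hy, hc, ζ, h0, hζ, rfl⟩ := h
  refine ⟨hx, hy, isChain_loopErasure _ hc, ?_⟩
  have h1 : loopErasure (x :: (ζ ++ [y])) = x :: loopErasure (ζ ++ [y]) := by
    refine loopErasure_append_cons (q := []) ?_ (by simp)
    simp only [List.mem_append, List.mem_singleton, not_or]
    exact ⟨fun h => hx.1 (hζ _ h), hxy⟩
  have h2 := getLast?_loopErasure (ζ ++ [y])
  rw [List.getLast?_concat] at h2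
  obtain ⟨ξ, h3⟩ := List.getLast?_eq_some_iff.1 h2
  have h4 := head?_loopErasure (ζ ++ [y])
  have h5 := nodup_loopErasure (ζ ++ [y])
  have h6 := loopErasure_subset (ζ ++ [y])
  rw [h3] at h1 h4 h5 h6
  refine ⟨ξ, ?_, ?_, h1⟩
  · rintro rfl
    cases ζ with
    | nil => exact h0 rfl
    | cons a ζ =>
      have h7 : y = a := by simpa using h4
      exact hy.1 (h7 ▸ hζ a (by simp))
  · intro z hz
    have h7 := h6 (List.mem_append_left _ hz)
    rcases List.mem_append.1 h7 with h7 | h7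
    · exact hζ _ h7
    · obtain rfl : z = y := by simpa using h7
      exact absurd hz (by
        have := List.disjoint_of_nodup_append h5
        exact fun h => this h (by simp))

theorem exists_boundaryEdges_of_mem_excursionsBetween {A : Set (ℤ × ℤ)} {x y : ℤ × ℤ}
    {ω : List (ℤ × ℤ)} (h : ω ∈ excursionsBetween A x y) :
    ∃ (ζ : List (ℤ × ℤ)) (e e' : (ℤ × ℤ) × Fin 4), (∀ z ∈ ζ, z ∈ A) ∧ ζ.IsChain lattice.Adj ∧
      (∀ z ∈ ζ, z ∈ ω) ∧
      IsBoundaryEdgeAt A x e ∧ IsBoundaryEdgeAt A y e' ∧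
      ζ.head? = some e.1 ∧ ζ.getLast? = some e'.1 := by
  obtain ⟨hx, hy, hc, ζ, h0, hζ, rfl⟩ := h
  rw [List.isChain_cons, List.isChain_append] at hc
  obtain ⟨hc1, hc2, -, hc3⟩ := hc
  have hd := List.head?_eq_some_head h0
  have hl := List.getLast?_eq_getLast_of_ne_nil h0
  have h1 := hc1 (ζ.head h0) (by rw [List.head?_append, hd]; simp)
  have h2 := hc3 (ζ.getLast h0) (by rw [hl]; simp) y (by simp)
  obtain ⟨d, h1⟩ := exists_dir_eq_of_adj h1
  obtain ⟨d', h2⟩ := exists_eq_add_dir h2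
  exact ⟨ζ, (ζ.head h0, d), (ζ.getLast h0, d'), hζ, hc2,
    fun z hz => List.mem_cons_of_mem _ (List.mem_append_left _ hz),
    ⟨hζ _ (List.head_mem h0), hx.1, h1.symm⟩, ⟨hζ _ (List.getLast_mem h0), hy.1, h2.symm⟩, hd, hl⟩

theorem IsBoundaryEdgeAt.isBoundaryEdge {A : Set (ℤ × ℤ)} {z : ℤ × ℤ} {e : (ℤ × ℤ) × Fin 4}
    (h : IsBoundaryEdgeAt A z e) : IsBoundaryEdge A e :=
  ⟨h.1, h.2.2.symm ▸ h.2.1⟩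

/-- Excursions between interlaced pairs of boundary points meet. -/
theorem not_disjoint_of_mem_excursionsBetween {A : Set (ℤ × ℤ)}
    (hA : (lattice.induce Aᶜ).Connected) {z₁ z₂ z₃ z₄ : ℤ × ℤ}
    (hord : OrderedCounterclockwise A z₁ z₂ z₃ z₄) {ω ω' : List (ℤ × ℤ)}
    (hω : ω ∈ excursionsBetween A z₁ z₃) (hω' : ω' ∈ excursionsBetween A z₂ z₄) :
    ¬ ω.Disjoint ω' := by
  obtain ⟨ζ, e₁, e₃, h1, h2, h3, b1, b3, h4, h5⟩ := exists_boundaryEdges_of_mem_excursionsBetween hω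
  obtain ⟨ξ, e₂, e₄, k1, k2, k3, b2, b4, k4, k5⟩ :=
    exists_boundaryEdges_of_mem_excursionsBetween hω'
  intro hd
  exact not_disjoint_of_counterclockwise hA b1.isBoundaryEdge b2.isBoundaryEdge b3.isBoundaryEdge
    b4.isBoundaryEdge (hord.2.2.2.2 e₁ e₂ e₃ e₄ b1 b2 b3 b4) h1 k1 h2 k2 h4 h5 k4 k5
    fun z hz hz' => hd (h3 z hz) (k3 z hz')

theorem exists_mem_excursionsBetween {A : Set (ℤ × ℤ)} (hA : (lattice.induce A).Connected)
    {x y : ℤ × ℤ} (hx : x ∈ outerBoundary A) (hy : y ∈ outerBoundary A) :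
    ∃ ω, ω ∈ excursionsBetween A x y := by
  obtain ⟨a, ha, hxa⟩ := hx.2
  obtain ⟨b, hb, hyb⟩ := hy.2
  obtain ⟨l, h1, h2, h3⟩ := exists_path_of_connected hA ha hb
  refine ⟨_, hx, hy, ?_, a :: l, by simp, h3, rfl⟩
  rw [List.isChain_cons, List.isChain_append]
  refine ⟨?_, h1, by simp, ?_⟩
  · simpa using hxa
  · rw [h2]
    simpa using hyb.symm

/-! ### Sums over pairs of excursions -/

/-- Being an excursion splits at an interior point into a condition on the head and `x` and one on
the tail and `y`. This is what allows tails to be exchanged. -/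
theorem append_cons_mem_excursionsBetween {A : Set (ℤ × ℤ)} {x y v : ℤ × ℤ} (hv : v ∈ A)
    {p s : List (ℤ × ℤ)} : p ++ v :: s ∈ excursionsBetween A x y ↔
      (x ∈ outerBoundary A ∧ (p ++ [v]).IsChain lattice.Adj ∧ ∃ p', p = x :: p' ∧ ∀ z ∈ p', z ∈ A) ∧
      (y ∈ outerBoundary A ∧ (v :: s).IsChain lattice.Adj ∧
        ∃ s', s = s' ++ [y] ∧ ∀ z ∈ s', z ∈ A) := by
  constructor
  · rintro ⟨hx, hy, hc, ζ, h0, hζ, h⟩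
    rw [List.isChain_split] at hc
    cases p with
    | nil =>
      obtain ⟨rfl, -⟩ := List.cons.inj h
      exact absurd hv hx.1
    | cons b p =>
      obtain ⟨rfl, h2⟩ := List.cons.inj h
      have h : p ++ v :: s = ζ ++ [y] := h2
      rcases List.eq_nil_or_concat s with rfl | ⟨s, c, rfl⟩
      · obtain ⟨-, h⟩ := List.append_inj' h rfl
        obtain rfl : v = y := by simpa using h
        exact absurd hv hy.1
      · rw [List.concat_eq_append] at h hc ⊢
        rw [← List.cons_append, ← List.append_assoc] at h
        obtain ⟨rfl, h'⟩ := List.append_inj' h rfl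
        obtain rfl : c = y := by simpa using h'
        exact ⟨⟨hx, hc.1, p, rfl, fun z hz => hζ z (by simp [hz])⟩, hy, hc.2, s, rfl,
          fun z hz => hζ z (by simp [hz])⟩
  · rintro ⟨⟨hx, hc, p, rfl, hp⟩, hy, hc', s, rfl, hs⟩
    refine ⟨hx, hy, List.isChain_split.2 ⟨hc, hc'⟩, p ++ v :: s, by simp, ?_, by simp⟩
    intro z hz
    rcases List.mem_append.1 hz with hz | hz
    · exact hp z hz
    · rcases List.mem_cons.1 hz with rfl | hz
      · exact hv
      · exact hs z hz

theorem mem_of_mem_excursionsBetween {A : Set (ℤ × ℤ)} {x y v : ℤ × ℤ} {ω : List (ℤ × ℤ)}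
    (h : ω ∈ excursionsBetween A x y) (hv : v ∈ ω) : v = x ∨ v = y ∨ v ∈ A := by
  obtain ⟨-, -, -, ζ, -, hζ, rfl⟩ := h
  simp only [List.mem_cons, List.mem_append, List.not_mem_nil, or_false] at hv
  rcases hv with hv | hv | hv
  · exact Or.inl hv
  · exact Or.inr (Or.inr (hζ v hv))
  · exact Or.inr (Or.inl hv)

/-- The mass that simple random walk gives to a path. -/
def pathWeight (l : List (ℤ × ℤ)) : ENNReal := (4 : ENNReal)⁻¹ ^ (l.length - 1)

/-- The pairs of excursions for which the loop erasure of the first meets the second. -/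
def meetingPairs (A : Set (ℤ × ℤ)) (x₁ y₁ x₂ y₂ : ℤ × ℤ) : Set (List (ℤ × ℤ) × List (ℤ × ℤ)) :=
  {ω | ω.1 ∈ excursionsBetween A x₁ y₁ ∧ ω.2 ∈ excursionsBetween A x₂ y₂ ∧
    ¬ (loopErasure ω.1).Disjoint ω.2}

/-- Two paths cut at a common point: the parts `(p, s)` and `(q, t)` of each, and the point. -/
abbrev CutPair : Type :=
  (List (ℤ × ℤ) × List (ℤ × ℤ)) × (List (ℤ × ℤ) × List (ℤ × ℤ)) × (ℤ × ℤ)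

/-- The two paths from which a `CutPair` comes. -/
def CutPair.join (c : CutPair) : List (ℤ × ℤ) × List (ℤ × ℤ) :=
  (c.1.1 ++ c.2.2 :: c.1.2, c.2.1.1 ++ c.2.2 :: c.2.1.2)

/-- Exchange of the tails. -/
def CutPair.swap (c : CutPair) : CutPair :=
  ((c.1.1, c.2.1.2), (c.2.1.1, c.1.2), c.2.2)

/-- The pairs of excursions cut at the first point of the loop erasure of the first excursion
that the second one visits. -/
def tailCuts (A : Set (ℤ × ℤ)) (x₁ y₁ x₂ y₂ : ℤ × ℤ) : Set CutPair :=
  {c | IsTailCut c.1.1 c.1.2 c.2.1.1 c.2.1.2 c.2.2 ∧ c.join.1 ∈ excursionsBetween A x₁ y₁ ∧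
    c.join.2 ∈ excursionsBetween A x₂ y₂}

theorem join_image_tailCuts (A : Set (ℤ × ℤ)) (x₁ y₁ x₂ y₂ : ℤ × ℤ) :
    CutPair.join '' tailCuts A x₁ y₁ x₂ y₂ = meetingPairs A x₁ y₁ x₂ y₂ := by
  ext ⟨l, m⟩
  constructor
  · rintro ⟨c, ⟨h1, h2, h3⟩, h⟩
    rw [← h]
    exact ⟨h2, h3, h1.not_disjoint⟩
  · rintro ⟨h1, h2, h3⟩
    obtain ⟨p, s, q, t, v, rfl, rfl, h⟩ := exists_isTailCut h3
    exact ⟨((p, s), (q, t), v), ⟨h, h1, h2⟩, rfl⟩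

theorem join_injOn_tailCuts (A : Set (ℤ × ℤ)) (x₁ y₁ x₂ y₂ : ℤ × ℤ) :
    Set.InjOn CutPair.join (tailCuts A x₁ y₁ x₂ y₂) := by
  rintro ⟨⟨p, s⟩, ⟨q, t⟩, v⟩ ⟨h, -⟩ ⟨⟨p', s'⟩, ⟨q', t'⟩, v'⟩ ⟨h', -⟩ e
  obtain ⟨e1, e2⟩ := Prod.mk.inj e
  obtain ⟨rfl, rfl, rfl, rfl, rfl⟩ := h.unique h' e1 e2
  rfl

theorem swap_mem_tailCuts {A : Set (ℤ × ℤ)} {x₁ y₁ x₂ y₂ : ℤ × ℤ} (h₁ : x₁ ≠ x₂) (h₂ : x₁ ≠ y₂)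
    (h₃ : y₁ ≠ x₂) (h₄ : y₁ ≠ y₂) {c : CutPair} (hc : c ∈ tailCuts A x₁ y₁ x₂ y₂) :
    c.swap ∈ tailCuts A x₁ y₂ x₂ y₁ := by
  obtain ⟨⟨p, s⟩, ⟨q, t⟩, v⟩ := c
  obtain ⟨h, hl, hm⟩ := hc
  have hl : p ++ v :: s ∈ excursionsBetween A x₁ y₁ := hl
  have hm : q ++ v :: t ∈ excursionsBetween A x₂ y₂ := hm
  -- The two paths have no endpoint in common, so `v` is interior to at least one of them.
  have hv : v ∈ A := by
    rcases mem_of_mem_excursionsBetween hl (v := v) (by simp) with h5 | h5 | h5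
    · rcases mem_of_mem_excursionsBetween hm (v := v) (by simp) with h6 | h6 | h6
      · exact absurd (h5.symm.trans h6) h₁
      · exact absurd (h5.symm.trans h6) h₂
      · exact h6
    · rcases mem_of_mem_excursionsBetween hm (v := v) (by simp) with h6 | h6 | h6
      · exact absurd (h5.symm.trans h6) h₃
      · exact absurd (h5.symm.trans h6) h₄
      · exact h6
    · exact h5
  rw [append_cons_mem_excursionsBetween hv] at hl hm
  exact ⟨h.swap, (append_cons_mem_excursionsBetween hv).2 ⟨hl.1, hm.2⟩,
    (append_cons_mem_excursionsBetween hv).2 ⟨hm.1, hl.2⟩⟩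

theorem pathWeight_join_swap (c : CutPair) :
    pathWeight c.swap.join.1 * pathWeight c.swap.join.2 =
      pathWeight c.join.1 * pathWeight c.join.2 := by
  unfold pathWeight CutPair.join CutPair.swap
  rw [← pow_add, ← pow_add]
  congr 1
  simp
  omega

/-- Exchanging the tails of two excursions preserves the total mass of the meeting pairs. -/
theorem tsum_meetingPairs_swap {A : Set (ℤ × ℤ)} {x₁ y₁ x₂ y₂ : ℤ × ℤ}
    (h : [x₁, x₂, y₂, y₁].Nodup) :
    ∑' ω : meetingPairs A x₁ y₁ x₂ y₂, pathWeight ω.1.1 * pathWeight ω.1.2 =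
      ∑' ω : meetingPairs A x₁ y₂ x₂ y₁, pathWeight ω.1.1 * pathWeight ω.1.2 := by
  simp only [List.nodup_cons, List.mem_cons, List.not_mem_nil, or_false, not_or] at h
  obtain ⟨⟨h1, h2, h3⟩, ⟨h4, h5⟩, h6, -⟩ := h
  -- `swap` is an involution by definitional unfolding, which gives both surjectivity and, below,
  -- injectivity.
  have himg : CutPair.swap '' tailCuts A x₁ y₁ x₂ y₂ = tailCuts A x₁ y₂ x₂ y₁ := by
    ext c
    constructor
    · rintro ⟨c, hc, rfl⟩
      exact swap_mem_tailCuts h1 h2 (Ne.symm h5) (Ne.symm h6) hc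
    · intro hc
      exact ⟨c.swap, swap_mem_tailCuts h1 h3 (Ne.symm h4) h6 hc, rfl⟩
  have hinj : Set.InjOn CutPair.swap (tailCuts A x₁ y₁ x₂ y₂) := by
    intro c _ c' _ hcc
    exact congrArg CutPair.swap hcc
  rw [← join_image_tailCuts, ← join_image_tailCuts,
    tsum_image (fun ω => pathWeight ω.1 * pathWeight ω.2) (join_injOn_tailCuts A x₁ y₁ x₂ y₂),
    tsum_image (fun ω => pathWeight ω.1 * pathWeight ω.2) (join_injOn_tailCuts A x₁ y₂ x₂ y₁),
    ← himg,
    tsum_image (fun c => pathWeight (CutPair.join c).1 * pathWeight (CutPair.join c).2) hinj]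
  exact tsum_congr fun c => (pathWeight_join_swap c.1).symm

/-- The total mass of the excursions from `x` to `y`. -/
def excursionMass (A : Set (ℤ × ℤ)) (x y : ℤ × ℤ) : ENNReal :=
  ∑' ω : excursionsBetween A x y, pathWeight ω

theorem tsum_prod_pathWeight (E F : Set (List (ℤ × ℤ))) :
    ∑' ω : ↥(E ×ˢ F), pathWeight ω.1.1 * pathWeight ω.1.2 =
      (∑' ω : E, pathWeight ω) * ∑' ω : F, pathWeight ω := by
  rw [← (Equiv.Set.prod E F).symm.tsum_eq, ENNReal.tsum_prod', ← ENNReal.tsum_mul_right]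
  refine tsum_congr fun a => ?_
  rw [← ENNReal.tsum_mul_left]
  rfl

/-- After the exchange the endpoints interlace around the boundary. The loop erasure of the first
path is itself an excursion, so by planarity it always meets the second path, and the meeting pairs
fill the whole product. -/
theorem tsum_meetingPairs {A : Set (ℤ × ℤ)} (hA : (lattice.induce Aᶜ).Connected)
    {x₁ y₁ x₂ y₂ : ℤ × ℤ} (h : OrderedCounterclockwise A x₁ x₂ y₂ y₁) :
    ∑' ω : meetingPairs A x₁ y₁ x₂ y₂, pathWeight ω.1.1 * pathWeight ω.1.2 =
      excursionMass A x₁ y₂ * excursionMass A x₂ y₁ := by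
  rw [tsum_meetingPairs_swap h.nodup, excursionMass, excursionMass, ← tsum_prod_pathWeight]
  have hne : x₁ ≠ y₂ := by
    have := h.nodup
    simp only [List.nodup_cons, List.mem_cons, not_or] at this
    exact this.1.2.1
  have : meetingPairs A x₁ y₂ x₂ y₁ = excursionsBetween A x₁ y₂ ×ˢ excursionsBetween A x₂ y₁ := by
    ext ω
    refine ⟨fun hω => ⟨hω.1, hω.2.1⟩, fun hω => ⟨hω.1, hω.2, ?_⟩⟩
    exact not_disjoint_of_mem_excursionsBetween hA h
      (loopErasure_mem_excursionsBetween hne hω.1) hω.2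
  rw [this]

/-! ### The excursion Poisson kernel as a sum over excursions -/

theorem walk_zero (x : ℤ × ℤ) (ξ : ℕ → Fin 4) : walk x ξ 0 = x := by simp [walk]

theorem walk_succ (x : ℤ × ℤ) (ξ : ℕ → Fin 4) (n : ℕ) :
    walk x ξ (n + 1) = walk x ξ n + dir (ξ n) := by
  simp [walk, Finset.sum_range_succ, add_assoc]

/-- The event that the walk from `x` starts by following the path `ω`. -/
def followsPath (x : ℤ × ℤ) (ω : List (ℤ × ℤ)) : Set (ℕ → Fin 4) :=
  {ξ | (List.range ω.length).map (walk x ξ) = ω}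

/-- Each step of the path forces one direction, so the event is a cylinder in the first `l.length`
coordinates. -/
theorem exists_followsPath_eq_pi {x : ℤ × ℤ} {l : List (ℤ × ℤ)}
    (h : (x :: l).IsChain lattice.Adj) : ∃ δ : ℕ → Fin 4,
      followsPath x (x :: l) = Set.pi (Finset.range l.length) fun i => {δ i} := by
  have h1 : ∀ i, ∃ d, i < l.length → (x :: l).getD (i + 1) 0 = (x :: l).getD i 0 + dir d := by
    intro i
    by_cases hi : i < l.length
    · have h2 := List.isChain_iff_getElem.1 h i (by simpa using hi)
      obtain ⟨d, h3⟩ := exists_eq_add_dir h2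
      refine ⟨d, fun _ => ?_⟩
      rw [List.getD_eq_getElem _ _ (by simpa using hi), h3, List.getD_eq_getElem]
    -- Past the end of the path the direction is arbitrary.
    · exact ⟨0, fun h => absurd h hi⟩
  choose δ hδ using h1
  refine ⟨δ, ?_⟩
  have h4 : ∀ ξ, ξ ∈ followsPath x (x :: l) ↔ ∀ i ≤ l.length, walk x ξ i = (x :: l).getD i 0 := by
    intro ξ
    constructor
    · intro hξ i hi
      have h5 : (List.range (x :: l).length).map (walk x ξ) = x :: l := hξ
      rw [← h5, List.getD_eq_getElem _ _ (by simp; omega)]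
      simp
    · intro hξ
      refine List.ext_getElem (by simp) fun i h5 h6 => ?_
      rw [← List.getD_eq_getElem _ 0 h6, ← hξ i (by simpa [Nat.lt_succ_iff] using h6)]
      simp
  ext ξ
  rw [h4]
  simp only [Set.mem_pi, Finset.coe_range, Set.mem_Iio, Set.mem_singleton_iff]
  constructor
  · intro hξ i hi
    have h5 := hξ (i + 1) hi
    rw [walk_succ, hξ i hi.le, hδ i hi] at h5
    exact dir_injective (add_left_cancel h5)
  · intro hξ i
    induction i with
    | zero => simp [walk_zero]
    | succ i ih =>
      intro hi
      rw [walk_succ, ih (by omega), hδ i hi, hξ i hi]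

theorem measurableSet_followsPath {x : ℤ × ℤ} {l : List (ℤ × ℤ)}
    (h : (x :: l).IsChain lattice.Adj) : MeasurableSet (followsPath x (x :: l)) := by
  obtain ⟨δ, h⟩ := exists_followsPath_eq_pi h
  rw [h]
  exact MeasurableSet.pi (Finset.countable_toSet _) fun i _ => measurableSet_singleton _

theorem stepLaw_followsPath {x : ℤ × ℤ} {l : List (ℤ × ℤ)}
    (h : (x :: l).IsChain lattice.Adj) :
    stepLaw (followsPath x (x :: l)) = pathWeight (x :: l) := by
  obtain ⟨δ, h⟩ := exists_followsPath_eq_pi h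
  rw [h, stepLaw, Measure.infinitePi_pi _ fun i _ => measurableSet_singleton _]
  simp [pathWeight]

/-- The shape of an excursion with `n + 2` steps: the start, `n + 1 ≥ 1` interior points, the end.
-/
theorem map_range_add_three (S : ℕ → ℤ × ℤ) (n : ℕ) : (List.range (n + 3)).map S =
    S 0 :: ((List.range (n + 1)).map (fun i => S (i + 1)) ++ [S (n + 2)]) := by
  rw [List.range_succ_eq_map, List.map_cons, List.range_succ]
  simp [Function.comp_def]

theorem mem_followsPath_excursion {A : Set (ℤ × ℤ)} {x y : ℤ × ℤ} {ω : List (ℤ × ℤ)}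
    (hω : ω ∈ excursionsBetween A x y) {ξ : ℕ → Fin 4} (h : ξ ∈ followsPath x ω) :
    ∃ n, ω.length = n + 3 ∧ (∀ i < n + 1, walk x ξ (i + 1) ∈ A) ∧ walk x ξ (n + 2) = y := by
  obtain ⟨hx, hy, -, ζ, h0, hζ, rfl⟩ := hω
  obtain ⟨n, hn⟩ : ∃ n, ζ.length = n + 1 :=
    Nat.exists_eq_succ_of_ne_zero (by simpa using h0)
  have hlen : (x :: (ζ ++ [y])).length = n + 3 := by simp [hn]
  have h1 : (List.range (x :: (ζ ++ [y])).length).map (walk x ξ) = x :: (ζ ++ [y]) := h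
  rw [hlen, map_range_add_three] at h1
  obtain ⟨h2, h3⟩ := List.append_inj' (List.cons.inj h1).2 rfl
  refine ⟨n, hlen, fun i hi => hζ _ ?_, by simpa using h3⟩
  rw [← h2, List.mem_map]
  exact ⟨i, List.mem_range.2 hi, rfl⟩

theorem exit_event_eq_iUnion {A : Set (ℤ × ℤ)} {x y : ℤ × ℤ} (hx : x ∈ outerBoundary A)
    (hy : y ∈ outerBoundary A) :
    {ξ | walk x ξ 1 ∈ A ∧ ExitsAt A (walk x ξ) y} =
      ⋃ ω : excursionsBetween A x y, followsPath x ω.1 := by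
  ext ξ
  simp only [Set.mem_iUnion, Set.mem_ofPred_eq]
  constructor
  · rintro ⟨h1, τ, ⟨⟨h2, h3⟩, h4⟩, h5⟩
    -- The walk is in `A` at time `1`, so it exits at time `2` or later.
    obtain ⟨n, rfl⟩ : ∃ n, τ = n + 2 := by
      have : τ ≠ 1 := by
        rintro rfl
        exact h3 h1
      exact ⟨τ - 2, by omega⟩
    have h6 := map_range_add_three (walk x ξ) n
    rw [walk_zero, h5] at h6
    refine ⟨⟨(List.range (n + 3)).map (walk x ξ), hx, hy, ?_, _, by simp, ?_, h6⟩, ?_⟩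
    · rw [List.isChain_iff_getElem]
      intro i hi
      simp only [List.getElem_map, List.getElem_range, walk_succ]
      exact adj_add_dir _ _
    · intro z hz
      obtain ⟨i, hi, rfl⟩ := List.mem_map.1 hz
      by_contra hA
      have := h4 (show i + 1 ∈ {j : ℕ | 1 ≤ j ∧ walk x ξ j ∉ A} from ⟨by omega, hA⟩)
      have := List.mem_range.1 hi
      omega
    · simp [followsPath]
  · rintro ⟨ω, h⟩
    obtain ⟨n, -, h1, h2⟩ := mem_followsPath_excursion ω.2 h
    refine ⟨h1 0 (by omega), n + 2, ⟨⟨by omega, ?_⟩, ?_⟩, h2⟩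
    · rw [h2]
      exact hy.1
    · rintro j ⟨hj1, hj2⟩
      by_contra hlt
      refine hj2 ?_
      have := h1 (j - 1) (by omega)
      rwa [Nat.sub_add_cancel hj1] at this

/-- The length of a followed excursion is determined by the first exit time of the walk: the longer
of two would still be in `A` when the shorter has reached `y ∉ A`. Equal lengths give the same
initial segment. -/
theorem pairwise_disjoint_followsPath (A : Set (ℤ × ℤ)) (x y : ℤ × ℤ) :
    Pairwise (Function.onFun Disjoint fun ω : excursionsBetween A x y => followsPath x ω.1) := by
  intro ω ω' hne
  refine Set.disjoint_left.2 fun ξ h h' => hne ?_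
  obtain ⟨n, hn, h1, h2⟩ := mem_followsPath_excursion ω.2 h
  obtain ⟨n', hn', h1', h2'⟩ := mem_followsPath_excursion ω'.2 h'
  have hy := ω.2.2.1.1
  have hnn : n = n' := by
    rcases lt_trichotomy n n' with hlt | heq | hlt
    · exact absurd (h2 ▸ h1' (n + 1) (by omega)) hy
    · exact heq
    · exact absurd (h2' ▸ h1 (n' + 1) (by omega)) hy
  have e : (List.range ω.1.length).map (walk x ξ) = ω.1 := h
  have e' : (List.range ω'.1.length).map (walk x ξ) = ω'.1 := h'
  refine Subtype.ext ?_
  rw [← e, ← e', hn, hn', hnn]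

instance isProbabilityMeasure_stepLaw : IsProbabilityMeasure stepLaw := by
  unfold stepLaw
  infer_instance

theorem stepLaw_exit_event {A : Set (ℤ × ℤ)} {x y : ℤ × ℤ} (hx : x ∈ outerBoundary A)
    (hy : y ∈ outerBoundary A) :
    stepLaw {ξ | walk x ξ 1 ∈ A ∧ ExitsAt A (walk x ξ) y} = excursionMass A x y := by
  have h : ∀ ω : excursionsBetween A x y, MeasurableSet (followsPath x ω.1) ∧
      stepLaw (followsPath x ω.1) = pathWeight ω.1 := by
    rintro ⟨_, -, -, hc, ζ, -, -, rfl⟩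
    exact ⟨measurableSet_followsPath hc, stepLaw_followsPath hc⟩
  rw [exit_event_eq_iUnion hx hy, measure_iUnion (pairwise_disjoint_followsPath A x y)
    fun ω => (h ω).1]
  exact tsum_congr fun ω => (h ω).2

theorem excursionPoissonKernel_eq {A : Set (ℤ × ℤ)} {x y : ℤ × ℤ} (hx : x ∈ outerBoundary A)
    (hy : y ∈ outerBoundary A) :
    excursionPoissonKernel A x y = (excursionMass A x y).toReal := by
  rw [excursionPoissonKernel, Measure.real, stepLaw_exit_event hx hy]

theorem excursionMass_ne_top {A : Set (ℤ × ℤ)} {x y : ℤ × ℤ} (hx : x ∈ outerBoundary A)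
    (hy : y ∈ outerBoundary A) : excursionMass A x y ≠ ⊤ := by
  rw [← stepLaw_exit_event hx hy]
  exact measure_ne_top _ _

theorem excursionMass_ne_zero {A : Set (ℤ × ℤ)} (hA : (lattice.induce A).Connected)
    {x y : ℤ × ℤ} (hx : x ∈ outerBoundary A) (hy : y ∈ outerBoundary A) :
    excursionMass A x y ≠ 0 := by
  obtain ⟨ω, hω⟩ := exists_mem_excursionsBetween hA hx hy
  intro h
  have := ENNReal.tsum_eq_zero.1 h ⟨ω, hω⟩
  simp [pathWeight] at this

/-! ### The law of a simple random walk excursion -/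

theorem excursionMeasure_singleton {A : Set (ℤ × ℤ)} {l : List (ℤ × ℤ)} (hl : l ∈ excursions A) :
    excursionMeasure A {l} = pathWeight l := by
  rw [excursionMeasure, Measure.sum_apply _ (measurableSet_singleton l),
    tsum_eq_single (⟨l, hl⟩ : excursions A)]
  · simp [pathWeight]
  · intro ω hω
    have : ω.1 ≠ l := fun h => hω (Subtype.ext h)
    simp [this]

theorem excursionMeasure_excursionsBetween (A : Set (ℤ × ℤ)) (x y : ℤ × ℤ) :
    excursionMeasure A (excursionsBetween A x y) = excursionMass A x y := by
  rw [← Measure.tsum_indicator_apply_singleton _ _ (MeasurableSet.of_discrete), ← tsum_subtype,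
    excursionMass]
  exact tsum_congr fun ω => excursionMeasure_singleton ⟨x, y, ω.2⟩

theorem excursionLaw_singleton {A : Set (ℤ × ℤ)} {x y : ℤ × ℤ} {l : List (ℤ × ℤ)}
    (hl : l ∈ excursionsBetween A x y) :
    excursionLaw A x y {l} = (excursionMass A x y)⁻¹ * pathWeight l := by
  rw [excursionLaw, cond_apply MeasurableSet.of_discrete, excursionMeasure_excursionsBetween,
    Set.inter_eq_right.2 (Set.singleton_subset_iff.2 hl), excursionMeasure_singleton ⟨x, y, hl⟩]

theorem excursionLaw_singleton_eq_zero {A : Set (ℤ × ℤ)} {x y : ℤ × ℤ} {l : List (ℤ × ℤ)}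
    (hl : l ∉ excursionsBetween A x y) : excursionLaw A x y {l} = 0 := by
  rw [excursionLaw, cond_apply MeasurableSet.of_discrete, Set.inter_singleton_eq_empty.2 hl]
  simp

theorem isProbabilityMeasure_excursionLaw {A : Set (ℤ × ℤ)} {x y : ℤ × ℤ}
    (h0 : excursionMass A x y ≠ 0) (h1 : excursionMass A x y ≠ ⊤) :
    IsProbabilityMeasure (excursionLaw A x y) := by
  rw [← excursionMeasure_excursionsBetween] at h0 h1
  exact cond_isProbabilityMeasure_of_finite h0 h1

/-- The space of pairs is countable and discrete, so the measure is a sum over single pairs; each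
law charges only its own excursions, with weight divided by total mass. -/
theorem prod_excursionLaw_not_disjoint {A : Set (ℤ × ℤ)} {x₁ y₁ x₂ y₂ : ℤ × ℤ}
    [SFinite (excursionLaw A x₂ y₂)] :
    (excursionLaw A x₁ y₁).prod (excursionLaw A x₂ y₂)
        {ω | (loopErasure ω.1).Disjoint ω.2}ᶜ =
      (excursionMass A x₁ y₁)⁻¹ * (excursionMass A x₂ y₂)⁻¹ *
        ∑' ω : meetingPairs A x₁ y₁ x₂ y₂, pathWeight ω.1.1 * pathWeight ω.1.2 := by
  rw [← Measure.tsum_indicator_apply_singleton _ _ (MeasurableSet.of_discrete),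
    ← ENNReal.tsum_mul_left, tsum_subtype (meetingPairs A x₁ y₁ x₂ y₂) (fun ω =>
      (excursionMass A x₁ y₁)⁻¹ * (excursionMass A x₂ y₂)⁻¹ * (pathWeight ω.1 * pathWeight ω.2))]
  refine tsum_congr fun ω => ?_
  obtain ⟨l, m⟩ := ω
  by_cases hd : (loopErasure l).Disjoint m
  · rw [Set.indicator_of_notMem (by simpa using hd), Set.indicator_of_notMem]
    exact fun h => h.2.2 hd
  · rw [Set.indicator_of_mem (by simpa using hd), ← Set.singleton_prod_singleton,
      Measure.prod_prod]
    by_cases hl : l ∈ excursionsBetween A x₁ y₁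
    · by_cases hm : m ∈ excursionsBetween A x₂ y₂
      · rw [Set.indicator_of_mem (show (l, m) ∈ meetingPairs A x₁ y₁ x₂ y₂ from ⟨hl, hm, hd⟩),
          excursionLaw_singleton hl, excursionLaw_singleton hm]
        ring
      · rw [excursionLaw_singleton_eq_zero hm, mul_zero, Set.indicator_of_notMem]
        exact fun h => hm h.2.1
    · rw [excursionLaw_singleton_eq_zero hl, zero_mul, Set.indicator_of_notMem]
      exact fun h => hl h.1

end FominLERW

end

theorem mainTheorem2 (A : Set (ℤ × ℤ)) (hA : FominLERW.IsSimplyConnected A)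
    (h0 : ((0, 0) : ℤ × ℤ) ∈ A) (x₁ x₂ y₂ y₁ : ℤ × ℤ)
    (hord : FominLERW.OrderedCounterclockwise A x₁ x₂ y₂ y₁) :
    0 < FominLERW.excursionPoissonKernel A x₁ y₁ ∧
    0 < FominLERW.excursionPoissonKernel A x₂ y₂ ∧
    ((FominLERW.excursionLaw A x₁ y₁).prod (FominLERW.excursionLaw A x₂ y₂)).real
        {ω : List (ℤ × ℤ) × List (ℤ × ℤ) | (FominLERW.loopErasure ω.1).Disjoint ω.2} =
      Matrix.det !![FominLERW.excursionPoissonKernel A x₁ y₁,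
                    FominLERW.excursionPoissonKernel A x₁ y₂;
                    FominLERW.excursionPoissonKernel A x₂ y₁,
                    FominLERW.excursionPoissonKernel A x₂ y₂] /
        (FominLERW.excursionPoissonKernel A x₁ y₁ *
          FominLERW.excursionPoissonKernel A x₂ y₂) := by
  obtain ⟨bx₁, bx₂, by₂, by₁, -⟩ := id hord
  have z₁ := FominLERW.excursionMass_ne_zero hA.1 bx₁ by₁
  have z₂ := FominLERW.excursionMass_ne_zero hA.1 bx₂ by₂
  have t₁ := FominLERW.excursionMass_ne_top bx₁ by₁
  have t₂ := FominLERW.excursionMass_ne_top bx₂ by₂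
  have p₁ := ENNReal.toReal_pos z₁ t₁
  have p₂ := ENNReal.toReal_pos z₂ t₂
  have i₁ := FominLERW.isProbabilityMeasure_excursionLaw z₁ t₁
  have i₂ := FominLERW.isProbabilityMeasure_excursionLaw z₂ t₂
  rw [FominLERW.excursionPoissonKernel_eq bx₁ by₁, FominLERW.excursionPoissonKernel_eq bx₂ by₂,
    FominLERW.excursionPoissonKernel_eq bx₁ by₂, FominLERW.excursionPoissonKernel_eq bx₂ by₁]
  refine ⟨p₁, p₂, ?_⟩
  -- The tail exchange evaluates the probability of meeting, so the complement is taken here; the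
  -- product of the crossed masses becomes the off-diagonal term of the determinant.
  have h1 := probReal_compl_eq_one_sub
    (μ := (FominLERW.excursionLaw A x₁ y₁).prod (FominLERW.excursionLaw A x₂ y₂))
    (s := {ω : List (ℤ × ℤ) × List (ℤ × ℤ) | (FominLERW.loopErasure ω.1).Disjoint ω.2})
    MeasurableSet.of_discrete
  rw [Measure.real, FominLERW.prod_excursionLaw_not_disjoint,
    FominLERW.tsum_meetingPairs hA.2 hord] at h1
  simp only [ENNReal.toReal_mul, ENNReal.toReal_inv] at h1
  rw [Matrix.det_fin_two_of]
  have h2 : ∀ a b c r : ℝ, 0 < a → 0 < b → a⁻¹ * b⁻¹ * c = 1 - r → r = (a * b - c) / (a * b) := by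
    intro a b c r ha hb h
    field_simp at h ⊢
    linarith
  exact h2 _ _ _ _ p₁ p₂ h1
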